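/- For $n,k\in\mathbb{N}$, a $k$-partition of $n$ is a partition of the set $\{0,1,\dots,n-1\}$ into exactly $k$ nonempty pieces (blocks); let $(n)^k$ denote the set of all $k$-partitions of $n$. For $t\in(n)^m$, let $(t)^k$ denote the set of all $s\in(n)^k$ that are coarser than $t$, i.e. such that every block of $t$ is a subset of some block of $s$. **Corollary (Ramsey's theorem for $n$-parameter sets; Graham–Rothschild).** For all positive integers $r$, $k$ and $m$ with $k\le m$ there exists $n\in\mathbb{N}$ such that for every coloring $c:(n)^k\to\{0,1,\dots,r-1\}$ there exists $t\in(n)^m$ such that $c$ is constant on $(t)^k$. -/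

import Mathlib

/-- `(n)^k`: the partitions of `n = {0, …, n - 1}` into exactly `k` (nonempty) pieces. -/
abbrev KPartition (n k : ℕ) : Type :=
  {P : Finpartition (Finset.range n) // P.parts.card = k}

/-- `(t)^k`: the `k`-partitions `s` of `n` that are coarser than `t`, i.e. every block of `t`
is a subset of some block of `s`. -/
def KPartition.coarsenings {n m : ℕ} (t : KPartition n m) (k : ℕ) : Set (KPartition n k) :=
  {s | ∀ b ∈ t.1.parts, ∃ a ∈ s.1.parts, b ⊆ a}

/-! Numbering the blocks of a partition by their least elements turns `k`-partitions into rigid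
functions, and coarsenings of `t` into composites `f ∘ t`. The theorem thereby becomes a statement
about parameter words over an alphabet of `a` letters, proved by induction on the number `d` of
parameters, for all `a` at once.

For `d = 0` it is the Hales–Jewett theorem. For `d + 1`, fix the place `q` where the parameter `a`
first occurs and treat all positions up to `q` as letters: `d` parameters remain, and the case `d`
over `q + 1` letters makes the colour depend only on the prefix before `q`
(`GrahamRothschild.exists_prefix_determined`). That prefix has no parameters, so repeated use of the
case `d = 0` makes its colour depend only on which parameter of a word `u` it stops at
(`exists_rigid_forall_prefix_mono`). By pigeonhole many parameters of `u` share a colour; keeping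
only these gives the homogeneous word. -/

/-! ### Rigid functions -/

/-- `i` is the first argument at which `f` takes a value that is at least `j`, and `f i = j`. -/
def FirstAt (f : ℕ → ℕ) (i j : ℕ) : Prop :=
  f i = j ∧ ∀ i' < i, f i' < j

/-- `f` restricts to a surjection from `{0, …, n - 1}` onto `{0, …, k - 1}` which takes new values
in increasing order and is the identity on `{0, …, a - 1}`; outside its domain it is `0`. For
`0 < a` these are the words of length `n - a` over the alphabet `{0, …, a - 1}` in which the
parameters `a, …, k - 1` all occur. -/
structure Rigid (a n k : ℕ) (f : ℕ → ℕ) : Prop where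
  fix : ∀ i < a, f i = i
  lt : ∀ i < n, f i < k
  zero : ∀ i, n ≤ i → f i = 0
  first : ∀ j < k, ∃ i < n, FirstAt f i j

/-- The restriction of `f` to `{0, …, q - 1}`, extended by `0`. -/
def truncate (q : ℕ) (f : ℕ → ℕ) (i : ℕ) : ℕ := if i < q then f i else 0

theorem FirstAt.unique {f : ℕ → ℕ} {i i' j : ℕ} (h : FirstAt f i j) (h' : FirstAt f i' j) :
    i = i' := by
  rcases lt_trichotomy i i' with hlt | rfl | hlt
  · exact absurd h.1 (h'.2 i hlt).ne
  · rfl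
  · exact absurd h'.1 (h.2 i' hlt).ne

theorem FirstAt.comp {f t : ℕ → ℕ} {i q j : ℕ} (hf : FirstAt f q j) (ht : FirstAt t i q) :
    FirstAt (f ∘ t) i j :=
  ⟨by simp [ht.1, hf.1], fun i' hi' => hf.2 _ (ht.2 i' hi')⟩

theorem FirstAt.sInf_eq {f : ℕ → ℕ} {i j : ℕ} (h : FirstAt f i j) : sInf {i | f i = j} = i := by
  have hne : {i | f i = j}.Nonempty := ⟨i, h.1⟩
  refine le_antisymm (Nat.sInf_le h.1) (not_lt.1 fun hlt => ?_)
  exact absurd (Nat.sInf_mem hne) (h.2 _ hlt).ne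

namespace Rigid

variable {a n m k : ℕ} {f t : ℕ → ℕ}

theorem comp (ha : 0 < a) (hf : Rigid a m k f) (ht : Rigid a n m t) : Rigid a n k (f ∘ t) where
  fix i hi := by simp [ht.fix i hi, hf.fix i hi]
  lt i hi := hf.lt _ (ht.lt i hi)
  zero i hi := by simp [ht.zero i hi, hf.fix 0 ha]
  first j hj := by
    obtain ⟨q, hq, hfq⟩ := hf.first j hj
    obtain ⟨i, hi, hti⟩ := ht.first q hq
    exact ⟨i, hi, hfq.comp hti⟩

theorem le (hf : Rigid a n k f) : k ≤ n := by
  have h : Finset.range k ⊆ (Finset.range n).image f := by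
    intro j hj
    obtain ⟨i, hi, h⟩ := hf.first j (Finset.mem_range.1 hj)
    exact Finset.mem_image.2 ⟨i, Finset.mem_range.2 hi, h.1⟩
  simpa using (Finset.card_le_card h).trans Finset.card_image_le

theorem mono {b : ℕ} (hba : b ≤ a) (hf : Rigid a n k f) : Rigid b n k f :=
  ⟨fun i hi => hf.fix i (hi.trans_le hba), hf.lt, hf.zero, hf.first⟩

theorem le_of_firstAt {q : ℕ} (hf : Rigid a n k f) (h : FirstAt f q a) : a ≤ q := by
  by_contra! hq
  have := hf.fix q hq
  have := h.1
  omega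

theorem truncate_id (ha : a ≤ n) : Rigid a n n (truncate n id) where
  fix i hi := by simp [truncate, hi.trans_le ha]
  lt i hi := by simp [truncate, hi]
  zero i hi := by simp [truncate, hi]
  first j hj := ⟨j, hj, by simp [truncate, hj], fun i hi => by simp [truncate, hi.trans hj, hi]⟩

theorem truncate {q : ℕ} (hf : Rigid a n k f) (h : FirstAt f q a) :
    Rigid a q a (truncate q f) := by
  have haq := hf.le_of_firstAt h
  have hfix : ∀ i < a, _root_.truncate q f i = i := fun i hi => by
    simp [_root_.truncate, hi.trans_le haq, hf.fix i hi]
  refine ⟨hfix, fun i hi => ?_, fun i hi => ?_, fun j hj => ⟨j, hj.trans_le haq, hfix j hj, ?_⟩⟩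
  · simpa [_root_.truncate, hi] using h.2 i hi
  · simp [_root_.truncate, hi]
  · intro i hi
    rwa [hfix i (hi.trans hj)]

theorem ext_of_lt {g : ℕ → ℕ} (hf : Rigid a n k f) (hg : Rigid a n k g)
    (h : ∀ i < n, f i = g i) : f = g := by
  funext i
  rcases lt_or_ge i n with hi | hi
  · exact h i hi
  · rw [hf.zero i hi, hg.zero i hi]

instance finite (a n k : ℕ) : Finite {f // Rigid a n k f} := by
  refine Finite.of_injective
    (fun f : {f // Rigid a n k f} => fun i : Fin n => (⟨f.1 i, f.2.lt i i.2⟩ : Fin k)) ?_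
  intro f g h
  refine Subtype.ext (f.2.ext_of_lt g.2 fun i hi => ?_)
  simpa using congrFun h ⟨i, hi⟩

end Rigid

/-! ### The Graham–Rothschild theorem for rigid functions -/

/-- The Graham–Rothschild property for rigid functions with `d` parameters. -/
def GrahamRothschild (d : ℕ) : Prop :=
  ∀ a m : ℕ, 0 < a → a ≤ m → ∀ (κ : Type) [Finite κ] [Nonempty κ], ∃ n : ℕ,
    ∀ c : (ℕ → ℕ) → κ, ∃ t, Rigid a n m t ∧ ∃ x, ∀ f, Rigid a m (a + d) f → c (f ∘ t) = x

/-! ### No parameters: Hales–Jewett -/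

theorem GrahamRothschild.zero : GrahamRothschild 0 := by
  intro a m ha ham κ _ _
  -- The Hales–Jewett letters are whole words of length `m - a` over `{0, …, a - 1}`, so that one
  -- active coordinate has room for all parameters `a, …, m - 1`.
  obtain ⟨ι, _, hι⟩ := Combinatorics.Line.exists_mono_in_high_dimension {f // Rigid a m a f} κ
  obtain ⟨b, rfl⟩ := Nat.exists_eq_add_of_le ham
  let N := Fintype.card ι
  let φ : ι ≃ Fin N := Fintype.equivFin ι
  have hdiv : ∀ i, ¬ i < a → i < a + N * b → (i - a) / b < N := fun i h1 h2 => by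
    rw [Nat.div_lt_iff_lt_mul (Nat.pos_of_ne_zero fun h => by subst h; simp at h2; omega)]
    omega
  let asm : (ι → ℕ → ℕ) → ℕ → ℕ := fun y i =>
    if h : i < a then i else
      if h' : i < a + N * b then y (φ.symm ⟨(i - a) / b, hdiv i h h'⟩) (a + (i - a) % b) else 0
  have asm_block : ∀ y (p : Fin N) e, e < b → asm y (a + (p * b + e)) = y (φ.symm p) (a + e) := by
    intro y p e he
    have hlt : (p : ℕ) * b + e < N * b := by
      have := Nat.mul_le_mul_right b (Nat.succ_le_of_lt p.2)
      rw [Nat.succ_mul] at this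
      omega
    have hb : 0 < b := by omega
    have h1 : ((p : ℕ) * b + e) / b = p := by
      rw [Nat.mul_comm, Nat.mul_add_div hb, Nat.div_eq_of_lt he, Nat.add_zero]
    have h2 : ((p : ℕ) * b + e) % b = e := by
      rw [Nat.mul_comm, Nat.mul_add_mod, Nat.mod_eq_of_lt he]
    simp [asm, hlt, h1, h2]
  refine ⟨a + N * b, fun c => ?_⟩
  obtain ⟨l, x, hl⟩ := hι fun y => c (asm fun i => (y i).1)
  -- Active coordinates carry the block `a, …, a + b - 1` of all parameters; substituting `f` then
  -- yields the point of the line at `f`.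
  let y : ι → ℕ → ℕ := fun i => (l.idxFun i).elim id Subtype.val
  have hylt : ∀ i e, e < b → y i (a + e) < a + b := by
    intro i e he
    rcases h : l.idxFun i with _ | g
    · simpa [y, h] using he
    · simpa [y, h] using (g.2.lt (a + e) (by omega)).trans_le ham
  have hasm_lt : ∀ i, ¬ i < a → i < a + N * b → asm y i < a + b := by
    intro i h1 h2
    have hb : 0 < b := Nat.pos_of_ne_zero fun h => by subst h; simp at h2; omega
    simpa [asm, h1, h2] using hylt _ _ (Nat.mod_lt _ hb)
  refine ⟨asm y, ⟨fun i hi => by simp [asm, hi], fun i hi => ?_, fun i hi => ?_, fun j hj => ?_⟩,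
    x, fun f hf => ?_⟩
  · by_cases h : i < a
    · simp only [asm, h, dite_true]; omega
    · exact hasm_lt i h hi
  · have : ¬ i < a := by omega
    simp [asm, this, hi]
  · by_cases hja : j < a
    · exact ⟨j, by omega, by simp [asm, hja], fun i hi => by simp [asm, hi.trans hja, hi]⟩
    classical
    -- Every parameter first occurs in the least active block: earlier blocks contain only letters
    -- below `a`.
    have hex : ∃ p : ℕ, ∃ h : p < N, l.idxFun (φ.symm ⟨p, h⟩) = none := by
      obtain ⟨i, hi⟩ := l.proper
      exact ⟨φ i, (φ i).2, by simpa using hi⟩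
    obtain ⟨hp, hnone⟩ := Nat.find_spec hex
    have hmin := fun q => @Nat.find_min _ _ hex q
    generalize Nat.find hex = p at hp hnone hmin
    obtain ⟨e, rfl⟩ := Nat.exists_eq_add_of_le (not_lt.1 hja)
    have he : e < b := by omega
    refine ⟨a + (p * b + e), ?_, ?_, fun i hi => ?_⟩
    · have := Nat.mul_le_mul_right b (Nat.succ_le_of_lt hp)
      rw [Nat.succ_mul] at this
      omega
    · rw [asm_block y ⟨p, hp⟩ e he]
      simp [y, hnone]
    · by_cases hia : i < a
      · simp only [asm, hia, dite_true]; omega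
      have hb : 0 < b := by omega
      obtain ⟨s, rfl⟩ := Nat.exists_eq_add_of_le (not_lt.1 hia)
      have hs : s < p * b + e := by omega
      have hdm := Nat.div_add_mod s b
      rw [Nat.mul_comm] at hdm
      have hmod := Nat.mod_lt s hb
      have hq : s / b ≤ p := by
        rw [← Nat.lt_succ_iff, Nat.div_lt_iff_lt_mul hb, Nat.succ_mul]
        omega
      have hval := asm_block y ⟨s / b, hq.trans_lt hp⟩ (s % b) hmod
      simp only [hdm] at hval
      rw [hval]
      rcases hq.lt_or_eq with hq | hq
      · rcases hg : l.idxFun (φ.symm ⟨s / b, hq.trans hp⟩) with _ | g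
        · exact absurd ⟨hq.trans hp, hg⟩ (hmin _ hq)
        · have := g.2.lt (a + s % b) (by omega)
          simp only [y, hg, Option.elim]
          omega
      · simp only [hq, y, hnone, Option.elim, id]
        rw [hq] at hdm
        omega
  · rw [← hl ⟨f, hf⟩]
    congr 1
    funext i
    by_cases h1 : i < a
    · simp [asm, h1, hf.fix i h1]
    by_cases h2 : i < a + N * b
    · have hb : 0 < b := Nat.pos_of_ne_zero fun h => by subst h; simp at h2; omega
      simp only [asm, h1, h2, dite_true, dite_false, Function.comp, y,
        Combinatorics.Line.coe_apply]
      rcases hg : l.idxFun (φ.symm ⟨(i - a) / b, hdiv i h1 h2⟩) with _ | g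
      · simp
      · simpa using hf.fix _ (g.2.lt _ (by have := Nat.mod_lt (i - a) hb; omega))
    · simp [asm, h1, h2, hf.fix 0 ha]

/-! ### Making the colour depend on the prefix only -/

/-- Substitutes the word `w` for the first `q` letters. -/
def collapse (a q d : ℕ) (w : ℕ → ℕ) (i : ℕ) : ℕ :=
  if i < q then w i else if i < q + 1 + d then i - q + a else 0

theorem Rigid.collapse {a q d : ℕ} {w : ℕ → ℕ} (haq : a ≤ q) (hw : Rigid a q a w) :
    Rigid a (q + 1 + d) (a + (d + 1)) (collapse a q d w) where
  fix i hi := by simp [_root_.collapse, hi.trans_le haq, hw.fix i hi]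
  lt i hi := by
    unfold _root_.collapse
    split_ifs with h
    · have := hw.lt i h; omega
    · omega
  zero i hi := by
    have : ¬ i < q := by omega
    have : ¬ i < q + 1 + d := by omega
    simp [_root_.collapse, *]
  first j hj := by
    by_cases hja : j < a
    · refine ⟨j, by omega, by simp [_root_.collapse, hja.trans_le haq, hw.fix j hja], ?_⟩
      intro i hi
      simp [_root_.collapse, (hi.trans hja).trans_le haq, hw.fix i (hi.trans hja), hi]
    · refine ⟨q + (j - a), by omega, ?_, fun i hi => ?_⟩ <;> unfold _root_.collapse
      · rw [if_neg (by omega), if_pos (by omega)]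
        omega
      · split_ifs with h
        · have := hw.lt i h; omega
        · omega
        · omega

/-- A rigid function in which the parameter `a` first occurs at `q` factors through the collapse of
its restriction to `{0, …, q - 1}`. -/
theorem Rigid.exists_collapse_comp {a q d n : ℕ} {f : ℕ → ℕ} (ha : 0 < a)
    (hf : Rigid a n (a + (d + 1)) f) (hq : FirstAt f q a) :
    ∃ g, Rigid (q + 1) n (q + 1 + d) g ∧ _root_.collapse a q d (_root_.truncate q f) ∘ g = f := by
  have haq := hf.le_of_firstAt hq
  have hqn : q < n := by
    by_contra! h
    have := hf.zero q h
    have := hq.1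
    omega
  -- Positions up to `q` become letters, later letters below `a` stay, and parameters shift so that
  -- `a` becomes the letter `q`.
  refine ⟨fun i => if i ≤ q then i else if f i < a then f i else f i - a + q,
    ⟨fun i hi => ?_, fun i hi => ?_, fun i hi => ?_, fun j hj => ?_⟩, funext fun i => ?_⟩
  · simp [Nat.le_of_lt_succ hi]
  · have := hf.lt i hi
    split_ifs <;> omega
  · have : ¬ i ≤ q := by omega
    simp [this, hf.zero i hi, ha]
  · by_cases hjq : j ≤ q
    · refine ⟨j, by omega, by simp [hjq], fun i hi => ?_⟩
      have : i ≤ q := by omega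
      simpa [this] using hi
    · obtain ⟨i, hi, h1, h2⟩ := hf.first (j - q + a) (by omega)
      have hqi : q < i := by
        by_contra! h
        rcases h.lt_or_eq with h | h
        · have := hq.2 i h; omega
        · have := hq.1
          rw [h] at h1
          omega
      refine ⟨i, hi, ?_, fun i' hi' => ?_⟩
      · dsimp only
        rw [if_neg (by omega), if_neg (by omega)]
        omega
      · have := h2 i' hi'
        dsimp only
        split_ifs <;> omega
  · change _root_.collapse a q d _ (if i ≤ q then i else _) = f i
    rcases lt_trichotomy i q with h | h | h
    · simp [_root_.collapse, _root_.truncate, h, h.le]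
    · rw [if_pos h.le, h, hq.1, _root_.collapse, if_neg (lt_irrefl q), if_pos (by omega)]
      omega
    · rw [if_neg (not_le.2 h)]
      by_cases hfa : f i < a
      · simp [_root_.collapse, _root_.truncate, hfa, hfa.trans_le haq, hf.fix _ hfa]
      · have hlt : f i < a + (d + 1) := by
          by_cases hin : i < n
          · exact hf.lt i hin
          · rw [hf.zero i (by omega)]; omega
        rw [if_neg hfa, _root_.collapse, if_neg (by omega), if_pos (by omega)]
        omega

/-- Passing to a suitable `t`, the colour of a rigid function in which the parameter `a` first
occurs before `q` depends only on the part of the function that precedes this occurrence. -/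
theorem GrahamRothschild.exists_prefix_determined {d : ℕ} (hd : GrahamRothschild d) {a : ℕ}
    (ha : 0 < a) (κ : Type) [Finite κ] [Nonempty κ] (q : ℕ) (haq : a ≤ q) :
    ∀ M, q ≤ M → ∃ n, ∀ c : (ℕ → ℕ) → κ, ∃ t, Rigid a n M t ∧ ∀ p < q, ∀ f f',
      Rigid a M (a + (d + 1)) f → Rigid a M (a + (d + 1)) f' → FirstAt f p a → FirstAt f' p a →
      (∀ i < p, f i = f' i) → c (f ∘ t) = c (f' ∘ t) := by
  induction q, haq using Nat.le_induction with
  | base =>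
    intro M hM
    refine ⟨M, fun c => ⟨_, Rigid.truncate_id hM, fun p hp f f' hf _ hfp => ?_⟩⟩
    exact absurd (hf.le_of_firstAt hfp) (not_le.2 hp)
  | succ q haq ih =>
    intro M hM
    -- A colour here is a function of the prefix `w`, so that a single application of `hd` treats
    -- all prefixes of length `q` together.
    obtain ⟨n', hn'⟩ := hd (q + 1) M q.succ_pos hM ({w // Rigid a q a w} → κ)
    have hMn' : M ≤ n' := by
      obtain ⟨t, ht, -⟩ := hn' fun _ => Classical.arbitrary _
      exact ht.le
    obtain ⟨n, hn⟩ := ih n' (by omega)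
    refine ⟨n, fun c => ?_⟩
    obtain ⟨t, ht, htc⟩ := hn c
    obtain ⟨t', ht', x, hx⟩ := hn' fun g w => c ((collapse a q d w.1 ∘ g) ∘ t)
    have ht'a : Rigid a n' M t' := ht'.mono (by omega)
    have hfirst : ∀ p ≤ q, FirstAt t' p p := fun p hp =>
      ⟨ht'.fix p (by omega), fun i hi => by rwa [ht'.fix i (by omega)]⟩
    refine ⟨t' ∘ t, ht'a.comp ha ht, fun p hp f f' hf hf' hfp hfp' heq => ?_⟩
    -- Since `t'` fixes `0, …, q`, composing with it preserves prefixes and first occurrences before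
    -- `q`; what `t` achieved there survives.
    rcases (Nat.le_of_lt_succ hp).lt_or_eq with hpq | rfl
    · refine htc p hpq (f ∘ t') (f' ∘ t') (hf.comp ha ht'a) (hf'.comp ha ht'a)
        (hfp.comp (hfirst p hpq.le)) (hfp'.comp (hfirst p hpq.le)) fun i hi => ?_
      simp [ht'.fix i (by omega), heq i hi]
    · have key : ∀ h (hh : Rigid a M (a + (d + 1)) h) (hhp : FirstAt h p a),
          c (h ∘ t' ∘ t) = x ⟨truncate p h, hh.truncate hhp⟩ := by
        intro h hh hhp
        obtain ⟨g, hg, hgh⟩ := hh.exists_collapse_comp ha hhp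
        rw [← hx g hg]
        conv_lhs => rw [← hgh]
        rfl
      rw [key f hf hfp, key f' hf' hfp']
      congr 2
      funext i
      simp only [truncate]
      split_ifs with hi
      · exact heq i hi
      · rfl

/-! ### Making the prefix colours depend on the parameter only -/

/-- Given colourings `D i` of the words of length `i`, there is a `u` such that the colour of a word
that is substituted into the part of `u` before the first occurrence of a parameter depends only
on the parameter. -/
theorem exists_rigid_forall_prefix_mono {a : ℕ} (ha : 0 < a) (κ : Type) [Finite κ] [Nonempty κ]
    (L : ℕ) (haL : a ≤ L) :
    ∃ M, ∀ D : ℕ → (ℕ → ℕ) → κ, ∃ u, Rigid a M L u ∧ ∃ e : ℕ → κ, ∀ p, a ≤ p → p < L →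
      ∀ i, FirstAt u i p → ∀ w, Rigid a p a w → D i (truncate i (w ∘ u)) = e p := by
  induction L, haL using Nat.le_induction with
  | base =>
    exact ⟨a, fun D => ⟨_, Rigid.truncate_id le_rfl, fun _ => Classical.arbitrary κ,
      fun p h1 h2 => absurd h1 (not_le.2 h2)⟩⟩
  | succ L haL ih =>
    obtain ⟨M, hM⟩ := ih
    have hLM : L ≤ M := by
      obtain ⟨u, hu, -⟩ := hM fun _ _ => Classical.arbitrary κ
      exact hu.le
    obtain ⟨N, hN⟩ := GrahamRothschild.zero a M ha (by omega) κ
    have hMN : M ≤ N := by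
      obtain ⟨u, hu, -⟩ := hN fun _ => Classical.arbitrary κ
      exact hu.le
    refine ⟨N + 1, fun D => ?_⟩
    -- The last level is made constant first. The lower levels are then pulled back along `t`, where
    -- the infimum is the first occurrence of the parameter `p` in `t`.
    obtain ⟨t, ht, x, hx⟩ := hN (D N)
    obtain ⟨u, hu, e, he⟩ := hM fun p w =>
      D (sInf {i | t i = p}) (truncate (sInf {i | t i = p}) (w ∘ t))
    have hut := hu.comp ha ht
    -- The new parameter `L` is appended at position `N`, so the prefix before it is all of `u ∘ t`.
    set U : ℕ → ℕ := fun i => if i = N then L else (u ∘ t) i with hU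
    have hUlt : ∀ i < N, U i = (u ∘ t) i := fun i hi => by simp [hU, hi.ne]
    have hUN : U N = L := by simp [hU]
    have hfirst : ∀ {i j}, i < N → FirstAt (u ∘ t) i j → FirstAt U i j := fun hi h =>
      ⟨by rw [hUlt _ hi, h.1], fun i' hi' => by rw [hUlt _ (hi'.trans hi)]; exact h.2 i' hi'⟩
    have hfirstN : FirstAt U N L := ⟨hUN, fun i hi => by rw [hUlt i hi]; exact hut.lt i hi⟩
    have hrigid : Rigid a (N + 1) (L + 1) U := by
      refine ⟨fun i hi => ?_, fun i hi => ?_, fun i hi => ?_, fun j hj => ?_⟩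
      · rw [hUlt i (by omega), hut.fix i hi]
      · rcases (Nat.le_of_lt_succ hi).lt_or_eq with h | rfl
        · rw [hUlt i h]
          exact (hut.lt i h).trans L.lt_succ_self
        · rw [hUN]
          exact L.lt_succ_self
      · have : i ≠ N := by omega
        simpa [hU, this] using hut.zero i (by omega)
      · rcases (Nat.le_of_lt_succ hj).lt_or_eq with h | rfl
        · obtain ⟨i, hi, hij⟩ := hut.first j h
          exact ⟨i, by omega, hfirst hi hij⟩
        · exact ⟨N, N.lt_succ_self, hfirstN⟩
    refine ⟨U, hrigid, fun p => if p = L then x else e p, fun p hap hpL i hi w hw => ?_⟩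
    rcases (Nat.le_of_lt_succ hpL).lt_or_eq with hp | rfl
    · obtain ⟨j, hj, huj⟩ := hu.first p hp
      obtain ⟨i₀, hi₀, hti⟩ := ht.first j hj
      obtain rfl := hi.unique (hfirst hi₀ (huj.comp hti))
      have := he p hap hp j huj w hw
      rw [hti.sInf_eq] at this
      simp only [hp.ne, if_false]
      rw [← this]
      congr 1
      funext s
      simp only [truncate, Function.comp]
      split_ifs with h1 h2
      · rw [hUlt s (h1.trans hi₀)]
        rfl
      · exact absurd (hti.2 s h1) h2
      · rfl
    · obtain rfl := hi.unique hfirstN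
      simp only [if_true]
      rw [← hx _ (hw.comp ha hu)]
      congr 1
      funext s
      simp only [truncate]
      split_ifs with h
      · simp [hUlt s h]
      · simp [ht.zero s (not_lt.1 h), hu.fix 0 ha, hw.fix 0 ha]

/-! ### Selecting parameters and the induction step -/

theorem Finset.count_mem_lt_card {S : Finset ℕ} {i : ℕ} (hi : i ∈ S) :
    Nat.count (· ∈ S) i < S.card := by
  rw [Nat.count_eq_card_filter_range]
  refine Finset.card_lt_card ⟨fun j hj => (Finset.mem_filter.1 hj).2, fun h => ?_⟩
  simpa using h hi

theorem Finset.exists_mem_count_eq {S : Finset ℕ} {j : ℕ} (hj : j < S.card) :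
    ∃ s ∈ S, Nat.count (· ∈ S) s = j := by
  have hcard : ∀ hf : {i | i ∈ S}.Finite, j < hf.toFinset.card := by
    intro hf
    rwa [show hf.toFinset = S by ext; simp]
  exact ⟨_, Nat.nth_mem _ hcard, Nat.count_nth hcard⟩

/-- For a set `S` of positions there is a rigid function whose parameters first occur precisely at
the elements of `S`. -/
theorem exists_rigid_firstAt {a L : ℕ} (haL : a ≤ L) (ha : 0 < a) (S : Finset ℕ)
    (hS : S ⊆ Finset.Ico a L) :
    ∃ v, Rigid a L (a + S.card) v ∧ ∀ q, a ≤ q → q < a + S.card → ∃ s ∈ S, FirstAt v s q := by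
  have hSmem : ∀ i ∈ S, a ≤ i ∧ i < L := fun i hi => Finset.mem_Ico.1 (hS hi)
  let v : ℕ → ℕ := fun i => if i < a then i else if i ∈ S then a + Nat.count (· ∈ S) i else 0
  have hv : ∀ q, a ≤ q → q < a + S.card → ∃ s ∈ S, FirstAt v s q := by
    intro q haq hq
    obtain ⟨s, hmem, hc⟩ := Finset.exists_mem_count_eq (by omega : q - a < S.card)
    have has := (hSmem _ hmem).1
    refine ⟨_, hmem, ?_, fun i hi => ?_⟩
    · simp only [v, if_neg (not_lt.2 has), hmem, if_true, hc]
      omega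
    · simp only [v]
      split_ifs with h1 h2
      · omega
      · have := Nat.count_strict_mono (p := (· ∈ S)) h2 hi
        omega
      · omega
  refine ⟨v, ⟨fun i hi => by simp [v, hi], fun i hi => ?_, fun i hi => ?_, fun j hj => ?_⟩, hv⟩
  · simp only [v]
    split_ifs with h1 h2
    · omega
    · have := Finset.count_mem_lt_card h2; omega
    · omega
  · have h1 : ¬ i < a := by omega
    have h2 : i ∉ S := fun h => by have := (hSmem i h).2; omega
    simp [v, h1, h2]
  · by_cases hja : j < a
    · exact ⟨j, by omega, by simp [v, hja], fun i hi => by simp [v, hi.trans hja, hi]⟩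
    · obtain ⟨s, hs, h⟩ := hv j (by omega) hj
      exact ⟨s, (hSmem s hs).2, h⟩

theorem GrahamRothschild.succ {d : ℕ} (hd : GrahamRothschild d) : GrahamRothschild (d + 1) := by
  classical
  intro a m ha ham κ _ _
  have := Fintype.ofFinite κ
  -- This leaves `Fintype.card κ * m` parameters, so some colour class of `e` has at least `m ≥ m -
  -- a` of them.
  set L := a + Fintype.card κ * m with hL
  obtain ⟨M, hM⟩ := exists_rigid_forall_prefix_mono ha κ L (by omega)
  have hLM : L ≤ M := by
    obtain ⟨u, hu, -⟩ := hM fun _ _ => Classical.arbitrary κ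
    exact hu.le
  obtain ⟨n, hn⟩ := hd.exists_prefix_determined ha κ M (by omega) M le_rfl
  refine ⟨n, fun c => ?_⟩
  obtain ⟨t, ht, htc⟩ := hn c
  obtain ⟨D, hD⟩ : ∃ D : ℕ → (ℕ → ℕ) → κ, ∀ f i, Rigid a M (a + (d + 1)) f → FirstAt f i a →
      c (f ∘ t) = D i (truncate i f) := by
    -- `D` colours a prefix by any chosen extension of it; by `htc` the choice is immaterial.
    refine ⟨fun i w => if h : ∃ f, Rigid a M (a + (d + 1)) f ∧ FirstAt f i a ∧ ∀ i' < i, f i' = w i'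
      then c (h.choose ∘ t) else Classical.arbitrary κ, fun f i hf hfi => ?_⟩
    have h : ∃ g, Rigid a M (a + (d + 1)) g ∧ FirstAt g i a ∧ ∀ i' < i, g i' = truncate i f i' :=
      ⟨f, hf, hfi, fun i' hi' => by simp [truncate, hi']⟩
    refine Eq.trans ?_ (dif_pos h).symm
    obtain ⟨h1, h2, h3⟩ := h.choose_spec
    refine htc i ?_ f _ hf h1 hfi h2 fun i' hi' => ?_
    · by_contra! hi
      have := hf.zero i hi
      have := hfi.1
      omega
    · rw [h3 i' hi']
      simp [truncate, hi']
  obtain ⟨u, hu, e, he⟩ := hM D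
  obtain ⟨x, -, hx⟩ := Finset.exists_le_card_fiber_of_mul_le_card_of_maps_to
    (s := Finset.Ico a L) (t := Finset.univ) (f := e) (n := m) (fun _ _ => Finset.mem_univ _)
    Finset.univ_nonempty (by simp [hL])
  obtain ⟨S, hS, hScard⟩ := Finset.exists_subset_card_eq ((Nat.sub_le m a).trans hx)
  obtain ⟨v, hv, hvS⟩ := exists_rigid_firstAt (by omega : a ≤ L) ha S
    (hS.trans (Finset.filter_subset _ _))
  rw [hScard, Nat.add_sub_cancel' ham] at hv hvS
  refine ⟨(v ∘ u) ∘ t, (hv.comp ha hu).comp ha ht, x, fun f hf => ?_⟩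
  obtain ⟨q, hqm, hfq⟩ := hf.first a (by omega)
  -- The first parameter of `f ∘ v` occurs at some `s ∈ S`, where `e s = x`.
  obtain ⟨s, hs, hvs⟩ := hvS q (hf.le_of_firstAt hfq) hqm
  have hsm := Finset.mem_filter.1 (hS hs)
  have hsL := Finset.mem_Ico.1 hsm.1
  obtain ⟨i, -, hui⟩ := hu.first s hsL.2
  have hfv := hf.comp ha hv
  have hfvs := hfq.comp hvs
  have hmain := hD ((f ∘ v) ∘ u) i (hfv.comp ha hu) (hfvs.comp hui)
  have hw := he s hsL.1 hsL.2 i hui _ (hfv.truncate hfvs)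
  rw [hsm.2] at hw
  rw [← hw]
  refine hmain.trans ?_
  congr 1
  funext j
  simp only [truncate, Function.comp]
  split_ifs with h1 h2
  · rfl
  · exact absurd (hui.2 j h1) h2
  · rfl

theorem grahamRothschild (d : ℕ) : GrahamRothschild d := by
  induction d with
  | zero => exact GrahamRothschild.zero
  | succ d ih => exact ih.succ

/-! ### Partitions and rigid functions -/

/-- The fibres of a rigid function form a partition into `k` blocks. -/
theorem Rigid.exists_kPartition {a n k : ℕ} {f : ℕ → ℕ} (hf : Rigid a n k f) :
    ∃ P : KPartition n k, ∀ b, b ∈ P.1.parts ↔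
      ∃ j < k, b = (Finset.range n).filter (f · = j) := by
  classical
  have hinj : Set.InjOn (fun j => (Finset.range n).filter (f · = j)) (Finset.range k) := by
    intro j hj j' _ h
    obtain ⟨i, hi, hij⟩ := hf.first j (by simpa using hj)
    have hmem : i ∈ (Finset.range n).filter (f · = j) := by simp [hi, hij.1]
    have h' : (Finset.range n).filter (f · = j) = (Finset.range n).filter (f · = j') := h
    rw [h'] at hmem
    rw [← hij.1, (Finset.mem_filter.1 hmem).2]
  refine ⟨⟨⟨(Finset.range k).image fun j => (Finset.range n).filter (f · = j), ?_, ?_, ?_⟩, ?_⟩, ?_⟩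
  · rw [Finset.supIndep_iff_pairwiseDisjoint]
    intro b hb b' hb' hne
    simp only [Finset.coe_image, Set.mem_image] at hb hb'
    obtain ⟨j, -, rfl⟩ := hb
    obtain ⟨j', -, rfl⟩ := hb'
    simp only [Function.onFun, id]
    refine Finset.disjoint_left.2 fun i hi hi' => hne ?_
    rw [← (Finset.mem_filter.1 hi).2, ← (Finset.mem_filter.1 hi').2]
  · ext i
    simp only [Finset.mem_sup, Finset.mem_image, Finset.mem_range, id]
    constructor
    · rintro ⟨_, ⟨j, -, rfl⟩, hi⟩
      simpa using (Finset.mem_filter.1 hi).1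
    · intro hi
      exact ⟨_, ⟨f i, hf.lt i hi, rfl⟩, by simp [hi]⟩
  · simp only [Finset.bot_eq_empty, Finset.mem_image, Finset.mem_range, not_exists, not_and]
    intro j hj h
    obtain ⟨i, hi, hij⟩ := hf.first j hj
    have : i ∈ (Finset.range n).filter (f · = j) := by simp [hi, hij.1]
    rw [h] at this
    simp at this
  · simpa using Finset.card_image_of_injOn hinj
  · intro b
    simp [eq_comm]

/-- Every partition into `k` blocks is the partition into the fibres of a rigid function, which
numbers the blocks in the order of their least elements. -/
theorem KPartition.exists_rigid {n k : ℕ} (P : KPartition n k) :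
    ∃ g, Rigid 1 n k g ∧ ∀ b, b ∈ P.1.parts ↔ ∃ j < k, b = (Finset.range n).filter (g · = j) := by
  classical
  obtain ⟨P, hP⟩ := P
  let μ : ℕ → ℕ := fun i => sInf {x | x ∈ P.part i}
  have hself : ∀ i < n, i ∈ P.part i := fun i hi => P.mem_part (Finset.mem_range.2 hi)
  have hμmem : ∀ i < n, μ i ∈ P.part i := fun i hi => Nat.sInf_mem ⟨i, hself i hi⟩
  have hμle : ∀ i < n, μ i ≤ i := fun i hi => Nat.sInf_le (hself i hi)
  have hpart : ∀ i < n, P.part (μ i) = P.part i := fun i hi =>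
    P.part_eq_of_mem (P.part_mem.2 (Finset.mem_range.2 hi)) (hμmem i hi)
  have hμμ : ∀ i < n, μ (μ i) = μ i := fun i hi => by
    simp only [μ]
    exact congrArg (fun s : Finset ℕ => sInf {x | x ∈ s}) (hpart i hi)
  have hpart_iff : ∀ i < n, ∀ j < n, μ i = μ j ↔ P.part i = P.part j := fun i hi j hj =>
    ⟨fun h => by rw [← hpart i hi, h, hpart j hj], fun h => by simp only [μ, h]⟩
  let S := (Finset.range n).filter fun i => μ i = i
  have hScard : S.card = k := by
    rw [← hP]
    refine Finset.card_bij (fun i _ => P.part i) (fun i hi => ?_) (fun i hi j hj h => ?_)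
      fun b hb => ?_
    · exact P.part_mem.2 (Finset.mem_filter.1 hi).1
    · obtain ⟨hi, hi'⟩ := Finset.mem_filter.1 hi
      obtain ⟨hj, hj'⟩ := Finset.mem_filter.1 hj
      rw [← hi', ← hj', hpart_iff i (by simpa using hi) j (by simpa using hj)]
      exact h
    · obtain ⟨i, hi⟩ := P.nonempty_of_mem_parts hb
      have hin : i < n := Finset.mem_range.1 (P.le hb hi)
      refine ⟨μ i, Finset.mem_filter.2 ⟨?_, hμμ i hin⟩, ?_⟩
      · exact Finset.mem_range.2 ((hμle i hin).trans_lt hin)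
      · rw [hpart i hin]
        exact P.part_eq_of_mem hb hi
  have hSmem : ∀ i < n, μ i ∈ S := fun i hi =>
    Finset.mem_filter.2 ⟨Finset.mem_range.2 ((hμle i hi).trans_lt hi), hμμ i hi⟩
  have hSlt : ∀ i ∈ S, i < n := fun i hi => Finset.mem_range.1 (Finset.mem_filter.1 hi).1
  -- A block's number is the count of block minima below its own minimum.
  let g : ℕ → ℕ := fun i => if i < n then Nat.count (· ∈ S) (μ i) else 0
  have hg_iff : ∀ i < n, ∀ j < n, g i = g j ↔ P.part i = P.part j := fun i hi j hj => by
    rw [← hpart_iff i hi j hj]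
    simp only [g, hi, hj, if_true]
    exact ⟨fun h => Nat.count_injective (hSmem i hi) (hSmem j hj) h, fun h => by rw [h]⟩
  have hrigid : Rigid 1 n k g := by
    refine ⟨fun i hi => ?_, fun i hi => ?_, fun i hi => by simp [g, hi], fun j hj => ?_⟩
    · obtain rfl : i = 0 := by omega
      simp only [g]
      split_ifs with h
      · rw [Nat.le_zero.1 (hμle 0 h), Nat.count_zero]
      · rfl
    · simpa [g, hi, hScard] using Finset.count_mem_lt_card (hSmem i hi)
    · obtain ⟨s, hmem, hc⟩ := Finset.exists_mem_count_eq (hScard.symm ▸ hj)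
      have hsn := hSlt s hmem
      refine ⟨s, hsn, ?_, fun i hi => ?_⟩
      · simp only [g, hsn, if_true, (Finset.mem_filter.1 hmem).2, hc]
      · have hin := hi.trans hsn
        simp only [g, hin, if_true]
        rw [← hc]
        exact Nat.count_strict_mono (hSmem i hin) ((hμle i hin).trans_lt hi)
  refine ⟨g, hrigid, fun b => ?_⟩
  have hfib : ∀ i < n, P.part i = (Finset.range n).filter (g · = g i) := by
    intro i hi
    ext x
    simp only [Finset.mem_filter, Finset.mem_range]
    constructor
    · intro hx
      have hxn : x < n := Finset.mem_range.1 (P.part_subset i hx)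
      exact ⟨hxn, (hg_iff x hxn i hi).2 (P.part_eq_of_mem (P.part_mem.2 (Finset.mem_range.2 hi)) hx)⟩
    · rintro ⟨hxn, hx⟩
      rw [← (hg_iff x hxn i hi).1 hx]
      exact hself x hxn
  constructor
  · intro hb
    obtain ⟨i, hi⟩ := P.nonempty_of_mem_parts hb
    have hin : i < n := Finset.mem_range.1 (P.le hb hi)
    exact ⟨g i, hrigid.lt i hin, by rw [← hfib i hin]; exact (P.part_eq_of_mem hb hi).symm⟩
  · rintro ⟨j, hj, rfl⟩
    obtain ⟨i, hi, hij⟩ := hrigid.first j hj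
    rw [← hij.1, ← hfib i hi]
    exact P.part_mem.2 (Finset.mem_range.2 hi)

/-- A rigid function that is constant on the fibres of another one factors through it. -/
theorem Rigid.exists_comp_eq {a n m k : ℕ} {g t : ℕ → ℕ} (ha : 0 < a) (ham : a ≤ m)
    (hg : Rigid a n k g) (ht : Rigid a n m t)
    (h : ∀ i < n, ∀ i' < n, t i = t i' → g i = g i') : ∃ f, Rigid a m k f ∧ f ∘ t = g := by
  choose! φ hφn hφ using ht.first
  have hft : ∀ i < n, g (φ (t i)) = g i := fun i hi =>
    h _ (hφn _ (ht.lt i hi)) _ hi (hφ _ (ht.lt i hi)).1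
  have han : a ≤ n := ham.trans ht.le
  -- The factor evaluates `g` at the first occurrence `φ j` of `j` in `t`.
  refine ⟨fun j => if j < m then g (φ j) else 0,
    ⟨fun i hi => ?_, fun i hi => ?_, fun i hi => by simp [hi], fun j hj => ?_⟩, funext fun i => ?_⟩
  · have := hft i (by omega)
    rw [ht.fix i hi, hg.fix i hi] at this
    simpa [hi.trans_le ham] using this
  · simpa [hi] using hg.lt _ (hφn i hi)
  · obtain ⟨i, hi, hij⟩ := hg.first j hj
    refine ⟨t i, ht.lt i hi, ?_, fun q hq => ?_⟩
    · simp [ht.lt i hi, hft i hi, hij.1]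
    · have hqm : q < m := hq.trans (ht.lt i hi)
      simp only [hqm, if_true]
      refine hij.2 _ (not_le.1 fun hle => ?_)
      rcases hle.lt_or_eq with hlt | heq
      · exact absurd ((hφ q hqm).2 i hlt) (by omega)
      · have := (hφ q hqm).1
        rw [← heq] at this
        omega
  · by_cases hi : i < n
    · simp [ht.lt i hi, hft i hi]
    · have h0 := hft 0 (by omega)
      rw [ht.fix 0 ha] at h0
      simp only [Function.comp, ht.zero i (not_lt.1 hi), hg.zero i (not_lt.1 hi)]
      rw [if_pos (by omega), h0, hg.fix 0 ha]

theorem mainTheorem11 (r k m : ℕ) (hr : 0 < r) (hk : 0 < k) (hkm : k ≤ m) :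
    ∃ n : ℕ, ∀ c : KPartition n k → Fin r,
      ∃ t : KPartition n m, ∃ i : Fin r, ∀ s ∈ t.coarsenings k, c s = i := by
  classical
  have : Nonempty (Fin r) := ⟨⟨0, hr⟩⟩
  -- The one-letter alphabet only forces `0` to lie in block `0`; the other `k - 1` blocks are the
  -- parameters.
  obtain ⟨n, hn⟩ := grahamRothschild (k - 1) 1 m one_pos (by omega) (Fin r)
  rw [Nat.add_sub_cancel' hk] at hn
  refine ⟨n, fun c => ?_⟩
  obtain ⟨t, ht, x, hx⟩ := hn fun f =>
    if hf : Rigid 1 n k f then c hf.exists_kPartition.choose else ⟨0, hr⟩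
  obtain ⟨T, hT⟩ := ht.exists_kPartition
  refine ⟨T, x, fun s hs => ?_⟩
  obtain ⟨g, hg, hgs⟩ := s.exists_rigid
  -- Coarseness of `s` says exactly that `g` is constant on the fibres of `t`.
  have hfac : ∀ i < n, ∀ i' < n, t i = t i' → g i = g i' := by
    intro i hi i' hi' htt
    obtain ⟨b, hb, hsub⟩ := hs _ ((hT _).2 ⟨t i, ht.lt i hi, rfl⟩)
    obtain ⟨j, -, rfl⟩ := (hgs b).1 hb
    have h1 := (Finset.mem_filter.1 (hsub (by simp [hi] : i ∈ _))).2
    have h2 := (Finset.mem_filter.1 (hsub (by simp [hi', htt] : i' ∈ _))).2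
    rw [h1, h2]
  obtain ⟨f, hf, hfg⟩ := hg.exists_comp_eq one_pos (by omega) ht hfac
  rw [← hx f hf, hfg, dif_pos hg]
  congr 1
  refine Subtype.ext (Finpartition.ext (Finset.ext fun b => ?_))
  rw [hgs b, hg.exists_kPartition.choose_spec b]
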